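/- Let $R$ be a finite commutative ring with $1$ and let $U\subseteq R^\times$ be a subgroup of its group of units. Let $\mathtt{VIC}(R,U)$ be the category whose objects are the free modules $R^n$, $n\ge 0$, and whose morphisms $R^n\to R^{n'}$ are the pairs $(f,C)$, where $f\colon R^n\to R^{n'}$ is an injective $R$-linear map and $C\subseteq R^{n'}$ is a free submodule with $R^{n'}=f(R^n)\oplus C$, subject to the condition $\det(f)\in U$ if $n=n'$; composition is $(g,D)\circ(f,C)=(g\circ f,\;g(C)\oplus D)$. For a ring $\mathbf{k}$ (associative, not necessarily commutative), a $\mathtt{VIC}(R,U)$-module over $\mathbf{k}$ is a functor from $\mathtt{VIC}(R,U)$ to left $\mathbf{k}$-modules. A submodule of such a functor $M$ consists of $\mathbf{k}$-submodules of its values that are preserved by all the maps of $M$. A submodule $N$ of $M$ is finitely generated if there are finitely many elements of values of $N$ such that $N$ is the smallest submodule containing them. Then for every left Noetherian ring $\mathbf{k}$ the category of $\mathtt{VIC}(R,U)$-modules over $\mathbf{k}$ is Noetherian, that is, every submodule of a finitely generated $\mathtt{VIC}(R,U)$-module over $\mathbf{k}$ is finitely generated. This holds both for rings $\mathbf{k}$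 with $1$ and unital $\mathbf{k}$-modules, and for rings $\mathbf{k}$ that need not have a $1$, left Noetherian then meaning the ascending chain condition on left ideals and $\mathbf{k}$-modules being abelian groups with an additive, associative left action of $\mathbf{k}$. -/

import Mathlib

open CategoryTheory

universe u v w

/-! ### The category `VIC(R, U)` -/

/-- The objects of `VIC(R, U)`: the free modules `R ^ n`, one for each natural number `n`. -/
structure VIC (R : Type*) [CommRing R] (U : Subgroup Rˣ) where
  /-- the rank `n` of `R ^ n` -/
  rank : ℕ

namespace VIC

/-- The determinant of a linear map `R ^ m → R ^ n` with `m = n`. -/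
noncomputable def detOfEq {R : Type*} [CommRing R] {m n : ℕ} (h : m = n)
    (f : (Fin m → R) →ₗ[R] (Fin n → R)) : R :=
  LinearMap.det (LinearMap.funLeft R R (Fin.cast h) ∘ₗ f)

/-- A morphism `R ^ m → R ^ n` of `VIC(R, U)`: a pair `(f, C)` where `f` is an injective linear
map and `C` is a free submodule with `R ^ n = range f ⊕ C`; if `m = n`, then `det f ∈ U`. -/
@[ext]
structure Hom {R : Type*} [CommRing R] {U : Subgroup Rˣ} (X Y : VIC R U) where
  /-- the linear map `f` -/
  toLin : (Fin X.rank → R) →ₗ[R] (Fin Y.rank → R)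
  /-- the chosen complement `C` of the image of `f` -/
  compl : Submodule R (Fin Y.rank → R)
  injective : Function.Injective toLin
  free : Module.Free R compl
  isCompl : IsCompl (LinearMap.range toLin) compl
  det_mem : ∀ h : X.rank = Y.rank, ∃ u ∈ U, detOfEq h toLin = (u : R)

section Composition

variable {R : Type*} [CommRing R] {U : Subgroup Rˣ}

theorem detOfEq_comp {l m n : ℕ} (h : l = m) (h' : m = n)
    (f : (Fin l → R) →ₗ[R] (Fin m → R)) (g : (Fin m → R) →ₗ[R] (Fin n → R)) :
    detOfEq (h.trans h') (g ∘ₗ f) = detOfEq h' g * detOfEq h f := by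
  subst h h'
  exact LinearMap.det_comp g f

theorem isCompl_comp {A B D : Type*} [AddCommGroup A] [AddCommGroup B] [AddCommGroup D]
    [Module R A] [Module R B] [Module R D] (f : A →ₗ[R] B) (g : B →ₗ[R] D)
    (hg : Function.Injective g) {P : Submodule R B} {Q : Submodule R D}
    (hP : IsCompl (LinearMap.range f) P) (hQ : IsCompl (LinearMap.range g) Q) :
    IsCompl (LinearMap.range (g ∘ₗ f)) (P.map g ⊔ Q) := by
  have h1 : LinearMap.range (g ∘ₗ f) ⊔ P.map g = LinearMap.range g := by
    rw [LinearMap.range_comp, ← Submodule.map_sup, hP.sup_eq_top, Submodule.map_top]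
  constructor
  · rw [Submodule.disjoint_def]
    rintro x ⟨a, rfl⟩ hx
    obtain ⟨_, ⟨p, hp, rfl⟩, q, hq, hpq⟩ := Submodule.mem_sup.1 hx
    have hq' : q = g (f a - p) := by
      rw [map_sub, ← LinearMap.comp_apply, ← hpq, add_sub_cancel_left]
    have hq0 : q = 0 :=
      (Submodule.disjoint_def.1 hQ.disjoint) q (hq' ▸ LinearMap.mem_range_self g _) hq
    have hfp : f a = p := by
      rw [hq0] at hq'
      exact sub_eq_zero.1 (hg (by rw [map_zero]; exact hq'.symm))
    have hfa : f a = 0 :=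
      (Submodule.disjoint_def.1 hP.disjoint) (f a) (LinearMap.mem_range_self f a) (hfp ▸ hp)
    rw [LinearMap.comp_apply, hfa, map_zero]
  · rw [codisjoint_iff, ← sup_assoc, h1, hQ.sup_eq_top]

theorem free_sup {D : Type*} [AddCommGroup D] [Module R D] (P Q : Submodule R D)
    (h : Disjoint P Q) (hP : Module.Free R P) (hQ : Module.Free R Q) :
    Module.Free R (P ⊔ Q : Submodule R D) := by
  have hinj : Function.Injective (P.subtype.coprod Q.subtype) := by
    rw [← LinearMap.ker_eq_bot, LinearMap.ker_coprod_of_disjoint_range]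
    · simp
    · simpa using h
  have hr : LinearMap.range (P.subtype.coprod Q.subtype) = P ⊔ Q := by
    rw [LinearMap.range_coprod, Submodule.range_subtype, Submodule.range_subtype]
  exact Module.Free.of_equiv
    ((LinearEquiv.ofInjective _ hinj).trans (LinearEquiv.ofEq _ _ hr))

/-- The identity morphism `(id, 0)`. -/
noncomputable def Hom.id (X : VIC R U) : Hom X X where
  toLin := LinearMap.id
  compl := ⊥
  injective := Function.injective_id
  free := inferInstance
  isCompl := by rw [LinearMap.range_id]; exact isCompl_top_bot
  det_mem := fun _ => ⟨1, U.one_mem, by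
    rw [Units.val_one]; exact LinearMap.det_id⟩

/-- The composition `(g, D) ∘ (f, C) = (g ∘ f, g(C) ⊕ D)`. -/
noncomputable def Hom.comp {X Y Z : VIC R U} (p : Hom X Y) (q : Hom Y Z) : Hom X Z where
  toLin := q.toLin ∘ₗ p.toLin
  compl := p.compl.map q.toLin ⊔ q.compl
  injective := q.injective.comp p.injective
  free := by
    have := p.free
    exact free_sup _ _
      (q.isCompl.disjoint.mono_left (LinearMap.map_le_range))
      (Module.Free.of_equiv (Submodule.equivMapOfInjective q.toLin q.injective p.compl)) q.free
  isCompl := isCompl_comp _ _ q.injective p.isCompl q.isCompl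
  det_mem := fun h => by
    rcases subsingleton_or_nontrivial R with hR | hR
    · exact ⟨1, U.one_mem, Subsingleton.elim _ _⟩
    · have h1 : X.rank ≤ Y.rank := by
        simpa using LinearMap.finrank_le_finrank_of_injective p.injective
      have h2 : Y.rank ≤ Z.rank := by
        simpa using LinearMap.finrank_le_finrank_of_injective q.injective
      have hXY : X.rank = Y.rank := by omega
      have hYZ : Y.rank = Z.rank := by omega
      obtain ⟨u, hu, hu'⟩ := p.det_mem hXY
      obtain ⟨v, hv, hv'⟩ := q.det_mem hYZ
      exact ⟨v * u, U.mul_mem hv hu, by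
        rw [Units.val_mul, ← hu', ← hv', ← detOfEq_comp hXY hYZ]⟩

noncomputable instance : Category (VIC R U) where
  Hom := Hom
  id := Hom.id
  comp := Hom.comp
  id_comp p := by
    apply Hom.ext
    · exact LinearMap.comp_id _
    · change Submodule.map _ ⊥ ⊔ p.compl = p.compl
      rw [Submodule.map_bot, bot_sup_eq]
  comp_id p := by
    apply Hom.ext
    · exact LinearMap.id_comp _
    · change Submodule.map LinearMap.id p.compl ⊔ ⊥ = p.compl
      rw [Submodule.map_id, sup_bot_eq]
  assoc p q r := by
    apply Hom.ext
    · rfl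
    · change Submodule.map r.toLin (Submodule.map q.toLin p.compl ⊔ q.compl) ⊔ r.compl =
        Submodule.map (r.toLin ∘ₗ q.toLin) p.compl ⊔ (Submodule.map r.toLin q.compl ⊔ r.compl)
      rw [Submodule.map_sup, Submodule.map_comp, sup_assoc]

end Composition

end VIC

/-! ### Modules over a category, with coefficients in a unital ring -/

/-- A `C`-submodule of a `C`-module `M : C ⥤ ModuleCat k`: a submodule of each value of `M`,
preserved by all the maps of `M`. -/
structure CatSubmodule {k : Type v} [Ring k] {C : Type*} [Category C] (M : C ⥤ ModuleCat.{w} k) where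
  /-- the submodule of the value of `M` at an object -/
  obj : ∀ X : C, Submodule k (M.obj X)
  map_mem : ∀ {X Y : C} (f : X ⟶ Y) (x : M.obj X), x ∈ obj X → (M.map f).hom x ∈ obj Y

namespace CatSubmodule

variable {k : Type v} [Ring k] {C : Type*} [Category C] {M : C ⥤ ModuleCat.{w} k}

/-- The `C`-module `M` as a `C`-submodule of itself. -/
def whole (M : C ⥤ ModuleCat.{w} k) : CatSubmodule M where
  obj _ := ⊤
  map_mem _ _ _ := Submodule.mem_top

/-- A `C`-submodule `N` is finitely generated if it is the smallest `C`-submodule containing some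
finitely many elements `x i` of values `N (c i)`. -/
def FG (N : CatSubmodule M) : Prop :=
  ∃ (n : ℕ) (c : Fin n → C) (x : ∀ i, M.obj (c i)),
    (∀ i, x i ∈ N.obj (c i)) ∧
      ∀ P : CatSubmodule M, (∀ i, x i ∈ P.obj (c i)) → ∀ X, N.obj X ≤ P.obj X

end CatSubmodule

/-! ### Modules over a category, with coefficients in a ring that need not have a unit -/

/-- A ring, not necessarily with unit, is left Noetherian if every ascending chain of left ideals
becomes stationary. -/
def IsLeftNoetherianNonUnital (k : Type v) [NonUnitalRing k] : Prop :=
  ∀ I : ℕ →o AddSubgroup k, (∀ n, ∀ a : k, ∀ x ∈ I n, a * x ∈ I n) →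
    ∃ n, ∀ m, n ≤ m → I n = I m

/-- A `C`-module over a ring `k` that need not have a unit: a functor from `C` to left
`k`-modules, that is, a functor to abelian groups together with left actions of `k` on its values
(additive and multiplicative in `k`, additive on the values) that commute with all its maps. -/
structure NonUnitalCatModule (k : Type v) [NonUnitalRing k] (C : Type*) [Category C] where
  /-- the underlying functor to abelian groups -/
  toFunctor : C ⥤ AddCommGrpCat.{w}
  /-- the action of `k` -/
  act : ∀ X : C, k →ₙ+* AddMonoid.End (toFunctor.obj X)
  act_map : ∀ {X Y : C} (f : X ⟶ Y) (a : k) (x : toFunctor.obj X),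
    (toFunctor.map f).hom (act X a x) = act Y a ((toFunctor.map f).hom x)

/-- A `C`-submodule of a `C`-module: a `k`-submodule of each value, preserved by all the maps. -/
structure NonUnitalCatSubmodule {k : Type v} [NonUnitalRing k] {C : Type*} [Category C]
    (M : NonUnitalCatModule.{v, w} k C) where
  /-- the subgroup of the value of `M` at an object -/
  obj : ∀ X : C, AddSubgroup (M.toFunctor.obj X)
  smul_mem : ∀ {X : C} (a : k) (x : M.toFunctor.obj X), x ∈ obj X → M.act X a x ∈ obj X
  map_mem : ∀ {X Y : C} (f : X ⟶ Y) (x : M.toFunctor.obj X), x ∈ obj X →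
    (M.toFunctor.map f).hom x ∈ obj Y

namespace NonUnitalCatSubmodule

variable {k : Type v} [NonUnitalRing k] {C : Type*} [Category C] {M : NonUnitalCatModule.{v, w} k C}

/-- The `C`-module `M` as a `C`-submodule of itself. -/
def whole (M : NonUnitalCatModule.{v, w} k C) : NonUnitalCatSubmodule M where
  obj _ := ⊤
  smul_mem _ _ _ := AddSubgroup.mem_top _
  map_mem _ _ _ := AddSubgroup.mem_top _

/-- A `C`-submodule `N` is finitely generated if it is the smallest `C`-submodule containing some
finitely many elements `x i` of values `N (c i)`. -/
def FG (N : NonUnitalCatSubmodule M) : Prop :=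
  ∃ (n : ℕ) (c : Fin n → C) (x : ∀ i, M.toFunctor.obj (c i)),
    (∀ i, x i ∈ N.obj (c i)) ∧
      ∀ P : NonUnitalCatSubmodule M, (∀ i, x i ∈ P.obj (c i)) → ∀ X, N.obj X ≤ P.obj X

end NonUnitalCatSubmodule

/-! The argument is a Gröbner basis argument. A finitely generated module is a quotient of a finite
sum of free modules on the morphisms out of fixed objects, and submodules pull back to the free
module. There, leading terms with respect to a monomial order give finite generation as soon as
divisibility of morphisms is a well-quasi-order (`exists_finite_le_imageSpan`). It suffices that the
dividing morphism preserves comparisons with the leading monomial itself, since only terms below it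
occur.

For `VIC(R, U)`, a morphism `(f, C)` is the same as `f` with the retraction `r` of `f` that kills
`C`, hence the same as two sequences of vectors in `R ^ d`, with `d` the rank of the source: the
columns `x k` of `r` and the rows `y k` of `f`, with `∑ x k ⊗ y k` equal to the identity. A repeated
column `x i` can be inserted at a later place `j`, together with a copy of `y i`, if the rows are
corrected: with `x i = ∑ w k • x k`, each `y k` becomes `y k - w k • y i`. This is composition with
`insertHom`.

The correction would spoil a comparison of words, so the rows are replaced by tags. A pivot is a
column outside the span of the earlier ones, and `w` is supported on the pivots. Rewriting every
non-pivot column through earlier pivots turns `∑ x k ⊗ y k` into a sum over the pivots only; its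
coefficient at a pivot is the tag there, and at a non-pivot the tag is the row. Tags at pivots are
unchanged by the insertion, so composing with `insertHom` just copies one letter of the word of
columns, tags and pivot marks (`pivotWord_insertNth`). Words and morphisms determine each other
because the tags determine the rows (`pivotTag_injective`).

Finiteness of `R` makes the alphabet finite, and a variant of Higman's lemma
(`List.exists_reflTransGen_copyStep`) gives the well-quasi-order. Coefficient rings without unit
reduce to their unitization over `ℤ`. -/

/-! ### Noetherianity from monomial orders -/

/-- An object `X` of a category admits monomial orders if the sets of morphisms out of `X` carry
well-orders such that divisibility of morphisms (through a morphism that respects the order below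
the divisor) is a well-quasi-order. -/
def AdmitsMonomialOrders {C : Type*} [Category C] (X : C) : Prop :=
  ∃ lt : ∀ Y : C, (X ⟶ Y) → (X ⟶ Y) → Prop, (∀ Y, IsWellOrder (X ⟶ Y) (lt Y)) ∧
    WellQuasiOrdered fun a b : Σ Y, X ⟶ Y =>
      ∃ g : a.1 ⟶ b.1, a.2 ≫ g = b.2 ∧ ∀ f, lt a.1 f a.2 → lt b.1 (f ≫ g) b.2

/-! ### Leading terms in free modules -/

section FinsuppOrder

variable {k α β : Type*} [Ring k]

theorem Finsupp.exists_lead (lt : α → α → Prop) [IsWellOrder α lt] {x : α →₀ k} (hx : x ≠ 0) :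
    ∃ b, x b ≠ 0 ∧ ∀ b', lt b b' → x b' = 0 := by
  classical
  let := linearOrderOfSTO lt
  have hs : x.support.Nonempty := Finsupp.support_nonempty_iff.2 hx
  refine ⟨x.support.max' hs, Finsupp.mem_support_iff.1 (Finset.max'_mem _ hs), fun b' hb' => ?_⟩
  by_contra h
  exact absurd (Finset.le_max' _ _ (Finsupp.mem_support_iff.2 h)) (not_le.2 hb')

/-- The map `g` need not be injective: terms below `a` land strictly below `g a`, so nothing can
cancel or merge with the term at `a`. -/
theorem Finsupp.mapDomain_lead {lt : α → α → Prop} [IsWellOrder α lt] {lt' : β → β → Prop}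
    [IsWellOrder β lt'] {g : α → β} {a : α} (hg : ∀ a', lt a' a → lt' (g a') (g a))
    {x : α →₀ k} (hx : ∀ a', lt a a' → x a' = 0) :
    Finsupp.mapDomain g x (g a) = x a ∧ ∀ b, lt' (g a) b → Finsupp.mapDomain g x b = 0 := by
  classical
  have key : ∀ a' ∈ x.support, a' = a ∨ lt a' a := by
    intro a' ha'
    rcases trichotomous_of lt a' a with h | h | h
    · exact Or.inr h
    · exact Or.inl h
    · exact absurd (hx a' h) (Finsupp.mem_support_iff.1 ha')
  constructor
  · rw [Finsupp.mapDomain, Finsupp.sum_apply, Finsupp.sum, Finset.sum_eq_single a]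
    · simp
    · intro a' ha' hne
      rw [Finsupp.single_apply, if_neg]
      intro h
      rcases key a' ha' with h' | h'
      · exact hne h'
      · exact irrefl_of lt' (g a) (by simpa [h] using hg a' h')
    · intro ha
      simp [Finsupp.notMem_support_iff.1 ha]
  · intro b hb
    rw [Finsupp.mapDomain, Finsupp.sum_apply, Finsupp.sum, Finset.sum_eq_zero]
    intro a' ha'
    rw [Finsupp.single_apply, if_neg]
    rintro rfl
    rcases key a' ha' with h' | h'
    · subst h'; exact irrefl_of lt' _ hb
    · exact asymm_of lt' hb (hg a' h')

end FinsuppOrder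

/-! ### Finite generation in free modules by leading terms -/

section Groebner

variable {C : Type*} [Category C] {k : Type v} [Ring k] (B : C → Type*)
  (act : ∀ {Y Z : C}, (Y ⟶ Z) → B Y → B Z)

/-- The span in degree `Y` of all images of a set of elements of the free module on `B`. -/
noncomputable def imageSpan (S : Set (Σ Y, B Y →₀ k)) (Y : C) : Submodule k (B Y →₀ k) :=
  Submodule.span k {z | ∃ s ∈ S, ∃ g : s.1 ⟶ Y, z = Finsupp.mapDomain (act g) s.2}

theorem imageSpan_le {S : Set (Σ Y, B Y →₀ k)} {K : ∀ Y, Submodule k (B Y →₀ k)}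
    (hK : ∀ {Y Z : C} (g : Y ⟶ Z) x, x ∈ K Y → Finsupp.mapDomain (act g) x ∈ K Z)
    (hS : ∀ s ∈ S, s.2 ∈ K s.1) (Y : C) : imageSpan B act S Y ≤ K Y := by
  refine Submodule.span_le.2 ?_
  rintro _ ⟨s, hs, g, rfl⟩
  exact hK g _ (hS s hs)

/-- If no finite set suffices, elements outside the span of the earlier ones can be chosen forever,
each with smallest possible leading monomial. Along a subsequence whose monomials successively
divide each other, some leading coefficient is a combination of earlier ones, so the leading term
can be cancelled, against minimality. -/
theorem exists_finite_le_imageSpan [IsNoetherianRing k]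
    (act_id : ∀ (Y : C) (b : B Y), act (𝟙 Y) b = b)
    (act_comp : ∀ {X Y Z : C} (f : X ⟶ Y) (g : Y ⟶ Z) (b : B X), act (f ≫ g) b = act g (act f b))
    (lt : ∀ Y, B Y → B Y → Prop) [∀ Y, IsWellOrder (B Y) (lt Y)]
    (hwqo : WellQuasiOrdered fun a b : Σ Y, B Y =>
      ∃ g : a.1 ⟶ b.1, act g a.2 = b.2 ∧ ∀ f, lt a.1 f a.2 → lt b.1 (act g f) b.2)
    (K : ∀ Y, Submodule k (B Y →₀ k))
    (hK : ∀ {Y Z : C} (g : Y ⟶ Z) x, x ∈ K Y → Finsupp.mapDomain (act g) x ∈ K Z) :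
    ∃ S : Set (Σ Y, B Y →₀ k), S.Finite ∧ (∀ s ∈ S, s.2 ∈ K s.1) ∧
      ∀ Y, K Y ≤ imageSpan B act S Y := by
  classical
  by_contra! hcon
  have step : ∀ S : {S : Set (Σ Y, B Y →₀ k) // S.Finite ∧ ∀ s ∈ S, s.2 ∈ K s.1},
      ∃ (e : Σ Y, B Y) (x : B e.1 →₀ k), x ∈ K e.1 ∧ x ∉ imageSpan B act S.1 e.1 ∧
        (∀ b', lt e.1 e.2 b' → x b' = 0) ∧
        ∀ x' ∈ K e.1, (∀ b', ¬ lt e.1 b' e.2 → x' b' = 0) → x' ∈ imageSpan B act S.1 e.1 := by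
    rintro ⟨S, hS, hSK⟩
    obtain ⟨Y, hY⟩ := hcon S hS hSK
    obtain ⟨x₀, hx₀, hx₀'⟩ := SetLike.not_le_iff_exists.1 hY
    have hlead : ∀ x ∉ imageSpan B act S Y, ∃ b, x b ≠ 0 ∧ ∀ b', lt Y b b' → x b' = 0 := by
      intro x hx
      exact Finsupp.exists_lead (lt Y) fun h => hx (h ▸ Submodule.zero_mem _)
    have hne : ∃ b, ∃ x ∈ K Y, x ∉ imageSpan B act S Y ∧ ∀ b', lt Y b b' → x b' = 0 := by
      obtain ⟨b, -, hb⟩ := hlead x₀ hx₀'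
      exact ⟨b, x₀, hx₀, hx₀', hb⟩
    -- Minimality of `b` says that every element of `K Y` supported strictly below `b` already lies
    -- in the span.
    obtain ⟨b, ⟨x, hx, hxS, hxb⟩, hmin⟩ := (IsWellFounded.wf (r := lt Y)).has_min
      {b | ∃ x ∈ K Y, x ∉ imageSpan B act S Y ∧ ∀ b', lt Y b b' → x b' = 0} hne
    refine ⟨⟨Y, b⟩, x, hx, hxS, hxb, fun x' hx' hb' => ?_⟩
    by_contra hx'S
    obtain ⟨b'', hne'', hb''⟩ := hlead x' hx'S
    refine hmin b'' ⟨x', hx', hx'S, hb''⟩ ?_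
    by_contra h
    exact hne'' (hb' _ h)
  choose e x hxK hxS hxlead hxmin using step
  let nextSet : {S : Set (Σ Y, B Y →₀ k) // S.Finite ∧ ∀ s ∈ S, s.2 ∈ K s.1} →
      {S : Set (Σ Y, B Y →₀ k) // S.Finite ∧ ∀ s ∈ S, s.2 ∈ K s.1} := fun S =>
    ⟨insert ⟨(e S).1, x S⟩ S.1, S.2.1.insert _, by
      rintro s (rfl | hs)
      · exact hxK S
      · exact S.2.2 s hs⟩
  let L : ℕ → {S : Set (Σ Y, B Y →₀ k) // S.Finite ∧ ∀ s ∈ S, s.2 ∈ K s.1} := fun n =>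
    nextSet^[n] ⟨∅, Set.finite_empty, by simp⟩
  have hL : ∀ n, L (n + 1) = nextSet (L n) := fun n => Function.iterate_succ_apply' _ _ _
  have hLmono : Monotone fun n => (L n).1 := by
    refine monotone_nat_of_le_succ fun n => ?_
    simp only [hL]
    exact Set.subset_insert _ _
  have hLmem : ∀ m n, m < n → (⟨(e (L m)).1, x (L m)⟩ : Σ Y, B Y →₀ k) ∈ (L n).1 := by
    intro m n hmn
    refine hLmono (Nat.succ_le_of_lt hmn) ?_
    simp only [hL]
    exact Set.mem_insert _ _
  let r : (Σ Y, B Y) → (Σ Y, B Y) → Prop := fun a b =>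
    ∃ g : a.1 ⟶ b.1, act g a.2 = b.2 ∧ ∀ f, lt a.1 f a.2 → lt b.1 (act g f) b.2
  have : IsPreorder (Σ Y, B Y) r :=
    { refl := fun a => ⟨𝟙 _, act_id _ _, fun f hf => by rwa [act_id]⟩
      trans := by
        rintro a b c ⟨g, hg, hg'⟩ ⟨h, hh, hh'⟩
        refine ⟨g ≫ h, by rw [act_comp, hg, hh], fun f hf => ?_⟩
        rw [act_comp]
        exact hh' _ (hg' _ hf) }
  obtain ⟨φ, hφ⟩ := WellQuasiOrdered.exists_monotone_subseq (r := r) hwqo fun n => e (L n)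
  let lc : ℕ → k := fun t => x (L (φ t)) (e (L (φ t))).2
  let I : ℕ →o Submodule k k :=
    ⟨fun n => Submodule.span k (lc '' {t | t < n}), fun m n hmn =>
      Submodule.span_mono (Set.image_mono fun t (ht : t < m) => lt_of_lt_of_le ht hmn)⟩
  obtain ⟨n, hn⟩ := monotone_stabilizes_iff_noetherian.2 ‹IsNoetherianRing k› I
  have hmem : lc n ∈ I n := by
    rw [hn (n + 1) (Nat.le_succ n)]
    exact Submodule.subset_span ⟨n, Nat.lt_succ_self n, rfl⟩
  set S := L (φ n) with hSdef
  -- The elements of the span with no terms above the current leading monomial; their coefficients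
  -- there form a left ideal, which is shown to contain all earlier leading coefficients.
  let Q : Submodule k (B (e S).1 →₀ k) := imageSpan B act S.1 (e S).1 ⊓
    { carrier := {y | ∀ b', lt _ (e S).2 b' → y b' = 0}
      add_mem' := fun {a b} ha hb b' h => by simp [ha b' h, hb b' h]
      zero_mem' := fun _ _ => rfl
      smul_mem' := fun c a ha b' h => by simp [ha b' h] }
  have hI : I n ≤ Q.map (Finsupp.lapply (e S).2) := by
    refine Submodule.span_le.2 ?_
    rintro _ ⟨t, ht, rfl⟩
    have ht' : t < n := ht
    obtain ⟨g, hg, hg'⟩ := hφ t n ht'.le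
    rw [← hg] at hg'
    obtain ⟨h1, h2⟩ := Finsupp.mapDomain_lead (g := act g) hg' (hxlead (L (φ t)))
    refine ⟨Finsupp.mapDomain (act g) (x (L (φ t))), ⟨?_, ?_⟩, ?_⟩
    · exact Submodule.subset_span ⟨_, hLmem _ _ (φ.strictMono ht'), g, rfl⟩
    · intro b' hb'
      rw [← hg] at hb'
      exact h2 b' hb'
    · rw [Finsupp.lapply_apply]
      change Finsupp.mapDomain (act g) (x (L (φ t))) (e (L (φ n))).2 = _
      rw [← hg, h1]
  obtain ⟨y, ⟨hyS, hylead⟩, hy⟩ := hI hmem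
  refine hxS S ?_
  -- The terms at the leading monomial cancel, so the difference is supported strictly below it.
  have hd : x S - y ∈ imageSpan B act S.1 (e S).1 := by
    refine hxmin S _ (Submodule.sub_mem _ (hxK S) (imageSpan_le B act hK S.2.2 _ hyS)) ?_
    intro b' hb'
    rw [Finsupp.sub_apply]
    rcases trichotomous_of (lt (e S).1) b' (e S).2 with h | h | h
    · exact absurd h hb'
    · rw [h, sub_eq_zero]
      exact hy.symm
    · rw [hxlead S b' h, hylead b' h, sub_zero]
  simpa using Submodule.add_mem _ hd hyS

end Groebner

/-! ### From free modules to finitely generated modules -/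

section Modules

variable {C : Type*} [Category C] {k : Type v} [Ring k]

/-- There are finitely many summands, so a sequence has a subsequence inside one of them, where the
hypothesis applies. -/
theorem wellQuasiOrdered_sigma_hom {ι : Type*} [Finite ι] (c : ι → C)
    (lt : ∀ i (Y : C), (c i ⟶ Y) → (c i ⟶ Y) → Prop) (ltι : ι → ι → Prop) [Std.Irrefl ltι]
    (h : ∀ i, WellQuasiOrdered fun a b : Σ Y, c i ⟶ Y =>
      ∃ g : a.1 ⟶ b.1, a.2 ≫ g = b.2 ∧ ∀ f, lt i a.1 f a.2 → lt i b.1 (f ≫ g) b.2) :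
    WellQuasiOrdered fun a b : Σ Y, Σ i, c i ⟶ Y =>
      ∃ g : a.1 ⟶ b.1, (⟨a.2.1, a.2.2 ≫ g⟩ : Σ i, c i ⟶ b.1) = b.2 ∧
        ∀ f : Σ i, c i ⟶ a.1, Sigma.Lex ltι (fun i => lt i a.1) f a.2 →
          Sigma.Lex ltι (fun i => lt i b.1) ⟨f.1, f.2 ≫ g⟩ b.2 := by
  classical
  intro s
  obtain ⟨i, hi⟩ := Finite.exists_infinite_fiber fun n => (s n).2.1
  have hi' : Set.Infinite ((fun n => (s n).2.1) ⁻¹' {i}) := Set.infinite_coe_iff.1 hi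
  let φ := Nat.orderEmbeddingOfSet ((fun n => (s n).2.1) ⁻¹' {i})
  have hφ : ∀ n, (s (φ n)).2.1 = i := fun n => by
    have h1 : φ n ∈ Set.range φ := ⟨n, rfl⟩
    rw [Nat.orderEmbeddingOfSet_range] at h1
    exact h1
  have hs : ∀ n, ∃ a : Σ Y, c i ⟶ Y, s (φ n) = ⟨a.1, i, a.2⟩ := by
    intro n
    have := hφ n
    rcases hsn : s (φ n) with ⟨Y, j, f⟩
    rw [hsn] at this
    obtain rfl : j = i := this
    exact ⟨⟨Y, f⟩, rfl⟩
  choose a ha using hs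
  obtain ⟨m, n, hmn, g, hg, hg'⟩ := h i a
  refine ⟨φ m, φ n, φ.strictMono hmn, ?_⟩
  rw [ha m, ha n]
  refine ⟨g, by simp [hg], ?_⟩
  rintro ⟨j, f⟩ hf
  rcases hf with ⟨_, _, hlt⟩ | ⟨_, _, hlt⟩
  · exact Sigma.Lex.left _ _ hlt
  · exact Sigma.Lex.right _ _ (hg' _ hlt)

/-- The free modules on `Σ i, c i ⟶ Y` map onto `A`; generators of the preimage of `N` map to
generators of `N`. Stating this for bare families of modules serves the unital and the non-unital
case alike. -/
theorem exists_finite_generators_of_admitsMonomialOrders [IsNoetherianRing k]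
    (hC : ∀ X : C, AdmitsMonomialOrders X)
    (A : C → Type*) [∀ Y, AddCommGroup (A Y)] [∀ Y, Module k (A Y)]
    (m : ∀ {Y Z : C}, (Y ⟶ Z) → A Y →ₗ[k] A Z)
    (m_comp : ∀ {X Y Z : C} (f : X ⟶ Y) (g : Y ⟶ Z) (a : A X), m (f ≫ g) a = m g (m f a))
    {ι : Type} [Finite ι] (c : ι → C) (x : ∀ i, A (c i))
    (hx : ∀ Y, ⊤ ≤ Submodule.span k {z : A Y | ∃ i, ∃ f : c i ⟶ Y, z = m f (x i)})
    (N : ∀ Y, Submodule k (A Y)) (hN : ∀ {Y Z : C} (g : Y ⟶ Z) a, a ∈ N Y → m g a ∈ N Z) :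
    ∃ (n : ℕ) (d : Fin n → C) (y : ∀ i, A (d i)), (∀ i, y i ∈ N (d i)) ∧
      ∀ P : ∀ Y, Submodule k (A Y), (∀ {Y Z : C} (g : Y ⟶ Z) a, a ∈ P Y → m g a ∈ P Z) →
        (∀ i, y i ∈ P (d i)) → ∀ Y, N Y ≤ P Y := by
  classical
  choose lt hlt hwqo using fun i => hC (c i)
  let B : C → Type _ := fun Y => Σ i, c i ⟶ Y
  let act : ∀ {Y Z : C}, (Y ⟶ Z) → B Y → B Z := fun g b => ⟨b.1, b.2 ≫ g⟩
  let π : ∀ Y, (B Y →₀ k) →ₗ[k] A Y := fun Y =>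
    Finsupp.linearCombination k fun b : B Y => m b.2 (x b.1)
  have hπ : ∀ {Y Z : C} (g : Y ⟶ Z) (z : B Y →₀ k),
      π Z (Finsupp.mapDomain (act g) z) = m g (π Y z) := by
    intro Y Z g z
    simp only [π, Finsupp.linearCombination_mapDomain]
    rw [← LinearMap.comp_apply]
    congr 1
    ext b
    simp [act, m_comp]
  have hsurj : ∀ Y a, ∃ z, π Y z = a := by
    intro Y a
    have : a ∈ LinearMap.range (π Y) := by
      have h1 := hx Y (Submodule.mem_top (x := a))
      rw [Finsupp.range_linearCombination]
      refine Submodule.span_mono ?_ h1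
      rintro _ ⟨i, f, rfl⟩
      exact ⟨⟨i, f⟩, rfl⟩
    exact this
  let ltι : ι → ι → Prop := WellOrderingRel
  have : ∀ Y, IsWellOrder (B Y) (Sigma.Lex ltι fun i => lt i Y) := fun Y =>
    { wf := by
        refine Subrelation.wf (fun {a b} => ?_)
          (InvImage.wf (fun b : B Y => (⟨b.1, b.2⟩ : Σ' i, c i ⟶ Y))
            (WellFounded.psigma_lex (IsWellFounded.wf (r := ltι)) fun i => (hlt i Y).wf))
        revert a b
        rintro _ _ (⟨_, _, h⟩ | ⟨_, _, h⟩)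
        · exact PSigma.Lex.left _ _ h
        · exact PSigma.Lex.right _ h }
  obtain ⟨S, hS, hSK, hSgen⟩ := exists_finite_le_imageSpan (k := k) B act
    (fun Y b => by simp [act]) (fun f g b => by simp [act])
    (fun Y => Sigma.Lex ltι fun i => lt i Y)
    (wellQuasiOrdered_sigma_hom c lt ltι hwqo)
    (fun Y => (N Y).comap (π Y)) (fun g z hz => by
      rw [Submodule.mem_comap, hπ]
      exact hN g _ hz)
  have := hS.to_subtype
  obtain ⟨n, ⟨ε⟩⟩ := Finite.exists_equiv_fin S
  refine ⟨n, fun i => (ε.symm i).1.1, fun i => π _ (ε.symm i).1.2, fun i => hSK _ (ε.symm i).2, ?_⟩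
  intro P hP hyP Y a ha
  obtain ⟨z, rfl⟩ := hsurj Y a
  have h1 : imageSpan B act S Y ≤ (P Y).comap (π Y) := by
    refine imageSpan_le B act (K := fun Y => (P Y).comap (π Y)) (fun g z hz => ?_) ?_ Y
    · rw [Submodule.mem_comap, hπ]
      exact hP g _ hz
    · intro s hs
      have h2 := hyP (ε ⟨s, hs⟩)
      beta_reduce at h2
      rwa [ε.symm_apply_apply] at h2
  exact h1 (hSgen Y ha)

end Modules

/-! ### Words with insertions of repeated letters -/

namespace List

variable {α : Type*}

/-- Insertion into a word of a copy of a letter that satisfies `p` and occurs further left. -/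
inductive CopyStep (p : α → Prop) : List α → List α → Prop
  | insert {l₁ l₂ : List α} {a : α} (hp : p a) (ha : a ∈ l₁) : CopyStep p (l₁ ++ l₂) (l₁ ++ a :: l₂)

open Classical in
/-- Mark the letters of a word `l` that occur earlier in `l` or belong to `s`. -/
noncomputable def markSeen (s : Set α) : List α → List (α × Prop)
  | [] => []
  | a :: l => (a, a ∈ s) :: markSeen (insert a s) l

theorem mem_markSeen_of_notMem {s : Set α} {a : α} {l : List α} (ha : a ∈ l) (hs : a ∉ s) :
    (a, False) ∈ markSeen s l := by
  induction l generalizing s with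
  | nil => simp at ha
  | cons b l ih =>
    rw [markSeen]
    by_cases hab : a = b
    · subst hab
      simp [hs]
    · refine mem_cons_of_mem _ (ih ((mem_cons.1 ha).resolve_left hab) ?_)
      simp [hab, hs]

theorem notMem_markSeen_of_mem {s : Set α} {a : α} {l : List α} (hs : a ∈ s) :
    (a, False) ∉ markSeen s l := by
  induction l generalizing s with
  | nil => simp [markSeen]
  | cons b l ih =>
    rw [markSeen, mem_cons, not_or]
    refine ⟨fun h => ?_, ih (Set.mem_insert_of_mem _ hs)⟩
    rw [Prod.mk.injEq] at h
    obtain ⟨rfl, h⟩ := h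
    simp [hs] at h

/-- Marks force first occurrences to match first occurrences, so each unmatched letter of `l'` has
an earlier copy and can be inserted. The prefix `q` is the part of the word already completed. -/
theorem reflTransGen_copyStep_of_markSeen_sublist {p : α → Prop} (q l l' : List α)
    (h : markSeen {a | a ∈ q} l <+ markSeen {a | a ∈ q} l')
    (hmem : ∀ a ∈ l', a ∈ q ++ l) (hp : ∀ a, Duplicate a (q ++ l') → p a) :
    Relation.ReflTransGen (CopyStep p) (q ++ l) (q ++ l') := by
  induction l' generalizing q l with
  | nil =>
    rw [markSeen, sublist_nil] at h
    cases l with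
    | nil => exact .refl
    | cons a l => simp [markSeen] at h
  | cons a l' ih =>
    have hins : insert a {b | b ∈ q} = {b | b ∈ q ++ [a]} := by
      ext b
      simp [or_comm]
    have hq : ∀ t : List α, q ++ a :: t = (q ++ [a]) ++ t := fun t => by simp
    rw [markSeen, hins] at h
    generalize hm : markSeen {b | b ∈ q} l = w at h
    cases h with
    | cons _ h =>
      subst hm
      -- Otherwise `l` contains a first occurrence of `a`, which would have to match a letter after
      -- this one, where `a` is marked as seen.
      have haq : a ∈ q := by
        by_contra haq
        have hal : a ∈ l := (mem_append.1 (hmem a mem_cons_self)).resolve_left haq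
        exact notMem_markSeen_of_mem (s := {b | b ∈ q ++ [a]}) (by simp)
          (h.subset (mem_markSeen_of_notMem hal haq))
      have hpa : p a := hp a (by
        rw [duplicate_iff_sublist]
        exact ((singleton_sublist.2 haq).append (singleton_sublist.2 mem_cons_self)))
      refine .head (.insert hpa haq) ?_
      rw [hq l, hq l']
      refine ih _ _ ?_ ?_ ?_
      · have hs : {b | b ∈ q ++ [a]} = {b | b ∈ q} := by
          ext b
          simp only [mem_append, mem_singleton, Set.mem_ofPred_eq]
          exact ⟨fun h => h.elim id fun h => h ▸ haq, Or.inl⟩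
        rw [hs] at h ⊢
        exact h
      · intro b hb
        have := hmem b (mem_cons_of_mem _ hb)
        simp only [mem_append] at this ⊢
        tauto
      · intro b hb
        exact hp b (by rwa [hq])
    | cons_cons _ h =>
      rename_i w
      cases l with
      | nil => simp [markSeen] at hm
      | cons b l =>
        rw [markSeen, cons.injEq, Prod.mk.injEq] at hm
        obtain ⟨⟨rfl, -⟩, hm⟩ := hm
        rw [hins] at hm
        subst hm
        rw [hq l, hq l']
        refine ih _ _ h ?_ ?_
        · intro c hc
          have := hmem c (mem_cons_of_mem _ hc)
          simpa using this
        · intro c hc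
          exact hp c (by rwa [hq])

theorem wellQuasiOrdered_sublist [Finite α] : WellQuasiOrdered fun l l' : List α => l <+ l' := by
  have h := Set.PartiallyWellOrderedOn.partiallyWellOrderedOn_sublistForall₂ (α := α) (· = ·)
    (s := Set.univ) (Set.toFinite _).partiallyWellOrderedOn
  intro f
  obtain ⟨m, n, hmn, h⟩ := Set.partiallyWellOrderedOn_iff_exists_lt.1 h f (by simp)
  obtain ⟨l, hl, hl'⟩ := sublistForall₂_iff.1 h
  rw [forall₂_eq_eq_eq] at hl
  exact ⟨m, n, hmn, hl ▸ hl'⟩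

/-- A variant of Higman's lemma: words over a finite alphabet in which all the letters that occur
twice satisfy `p` are well-quasi-ordered by insertions of copies of letters that satisfy `p`. -/
theorem exists_reflTransGen_copyStep [Finite α] {p : α → Prop} (f : ℕ → List α)
    (hf : ∀ n a, Duplicate a (f n) → p a) :
    ∃ m n, m < n ∧ Relation.ReflTransGen (CopyStep p) (f m) (f n) := by
  have : IsPreorder (Set α) (· = ·) := {}
  -- Equal sets of letters ensure that every letter of the longer word has a first occurrence in the
  -- shorter one.
  obtain ⟨m, n, hmn, h₁, h₂⟩ := (Finite.wellQuasiOrdered (α := Set α) (· = ·)).prod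
    (wellQuasiOrdered_sublist (α := α × Prop)) fun n => ({a | a ∈ f n}, markSeen ∅ (f n))
  refine ⟨m, n, hmn, reflTransGen_copyStep_of_markSeen_sublist [] _ _ ?_ ?_ ?_⟩
  · simpa using h₂
  · intro a ha
    have : a ∈ {a | a ∈ f n} := ha
    have h₃ : {a | a ∈ f m} = {a | a ∈ f n} := h₁
    rw [← h₃] at this
    simpa using this
  · simpa using hf n

end List

/-! ### Pivots of a sequence of vectors -/

section Pivots

variable (R : Type*) {V : Type*} [CommRing R] [AddCommGroup V] [Module R V] {n : ℕ}

/-- An entry of a sequence of vectors is a pivot if it is not in the span of the previous ones. -/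
def IsPivot (x : Fin n → V) (k : Fin n) : Prop :=
  x k ∉ Submodule.span R (x '' {l | l < k})

/-- The set of values of the pivots at positions smaller than `j`. -/
def pivotsBefore (x : Fin n → V) (j : ℕ) : Set V :=
  x '' {k | (k : ℕ) < j ∧ IsPivot R x k}

theorem IsPivot.injOn (x : Fin n → V) : Set.InjOn x {k | IsPivot R x k} := by
  intro k hk l hl h
  rcases lt_trichotomy k l with hlt | rfl | hlt
  · exact (hl (Submodule.subset_span (h ▸ Set.mem_image_of_mem x (Set.mem_ofPred.2 hlt)))).elim
  · rfl
  · exact (hk (Submodule.subset_span (h ▸ Set.mem_image_of_mem x (Set.mem_ofPred.2 hlt)))).elim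

theorem span_pivotsBefore (x : Fin n → V) (j : ℕ) :
    Submodule.span R (pivotsBefore R x j) = Submodule.span R (x '' {k | (k : ℕ) < j}) := by
  apply le_antisymm
  · exact Submodule.span_mono (Set.image_mono fun k hk => hk.1)
  · suffices h : ∀ m : ℕ, ∀ k : Fin n, (k : ℕ) = m → m < j →
        x k ∈ Submodule.span R (pivotsBefore R x j) by
      refine Submodule.span_le.2 ?_
      rintro _ ⟨k, hk, rfl⟩
      exact h k k rfl hk
    intro m
    induction m using Nat.strong_induction_on with
    | _ m ih =>
      rintro k rfl hkj
      by_cases hk : IsPivot R x k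
      · exact Submodule.subset_span ⟨k, ⟨hkj, hk⟩, rfl⟩
      · refine Submodule.span_le.2 ?_ (not_not.1 hk)
        rintro _ ⟨l, hl, rfl⟩
        exact ih l hl l rfl (lt_trans hl hkj)

open Classical in
/-- Chosen coefficients that express a vector in the span of `P` through elements of `P`. -/
noncomputable def spanCoeff (P : Set V) (v : V) : V →₀ R :=
  if h : v ∈ Submodule.span R P then (Submodule.mem_span_set.1 h).choose else 0

theorem spanCoeff_support (P : Set V) (v : V) : ↑(spanCoeff R P v).support ⊆ P := by
  unfold spanCoeff
  split_ifs with h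
  · exact (Submodule.mem_span_set.1 h).choose_spec.1
  · simp

/-- The choice depends only on the set `P` and on `v`. Over a general ring the coefficients are not
unique, and this is what keeps them unchanged when positions shift. -/
theorem spanCoeff_sum {P : Set V} {v : V} (h : v ∈ Submodule.span R P) :
    ((spanCoeff R P v).sum fun u r => r • u) = v := by
  unfold spanCoeff
  rw [dif_pos h]
  exact (Submodule.mem_span_set.1 h).choose_spec.2

open Classical in
/-- Chosen coefficients that express a vector through the pivots at positions smaller than `j`. -/
noncomputable def pivotCoeff (x : Fin n → V) (j : ℕ) (v : V) (k : Fin n) : R :=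
  if IsPivot R x k then spanCoeff R (pivotsBefore R x j) v (x k) else 0

theorem pivotCoeff_of_not_isPivot {x : Fin n → V} {k : Fin n} (hk : ¬ IsPivot R x k) (j : ℕ)
    (v : V) : pivotCoeff R x j v k = 0 :=
  if_neg hk

theorem pivotCoeff_of_le (x : Fin n → V) {j : ℕ} (v : V) {k : Fin n} (hk : j ≤ k) :
    pivotCoeff R x j v k = 0 := by
  unfold pivotCoeff
  split_ifs with hp
  · by_contra h
    obtain ⟨l, ⟨hlj, hl⟩, hlk⟩ := spanCoeff_support R _ v (Finsupp.mem_support_iff.2 h)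
    obtain rfl := IsPivot.injOn R x hl hp hlk
    exact absurd hlj (not_lt.2 hk)
  · rfl

theorem sum_pivotCoeff (x : Fin n → V) {j : ℕ} {v : V}
    (hv : v ∈ Submodule.span R (x '' {k | (k : ℕ) < j})) :
    ∑ k, pivotCoeff R x j v k • x k = v := by
  classical
  rw [← span_pivotsBefore] at hv
  conv_rhs => rw [← spanCoeff_sum R hv]
  have hsub : (spanCoeff R (pivotsBefore R x j) v).support ⊆
      (Finset.univ.filter fun k => IsPivot R x k).image x := by
    intro u hu
    obtain ⟨k, ⟨-, hk⟩, rfl⟩ := spanCoeff_support R _ v hu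
    exact Finset.mem_image_of_mem _ (by simpa using hk)
  rw [Finsupp.sum_of_support_subset _ hsub _ (by simp), Finset.sum_image, Finset.sum_filter]
  · refine Finset.sum_congr rfl fun k _ => ?_
    unfold pivotCoeff
    split_ifs <;> simp
  · intro k hk l hl
    exact IsPivot.injOn R x (by simpa using hk) (by simpa using hl)

open Classical in
/-- The tags of a sequence `y`: they agree with `y` away from the pivots of `x`, and do not change
when a vector is inserted together with the compensating change of `y` at the pivots. -/
noncomputable def pivotTag (x y : Fin n → V) (k : Fin n) : V :=
  y k + ∑ i, if IsPivot R x i then 0 else pivotCoeff R x i (x i) k • y i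

theorem pivotTag_of_not_isPivot {x : Fin n → V} (y : Fin n → V) {k : Fin n}
    (hk : ¬ IsPivot R x k) : pivotTag R x y k = y k := by
  simp [pivotTag, pivotCoeff_of_not_isPivot R hk]

/-- The system is triangular: at non-pivots the tag is the entry itself, and at a pivot it differs
from the entry by a combination of entries at non-pivots. -/
theorem pivotTag_injective (x : Fin n → V) : Function.Injective (pivotTag R x) := by
  classical
  intro y y' h
  have h1 : ∀ i, ¬ IsPivot R x i → y i = y' i := fun i hi => by
    rw [← pivotTag_of_not_isPivot R y hi, ← pivotTag_of_not_isPivot R y' hi, h]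
  funext k
  have h3 : ∀ z : Fin n → V, pivotTag R x z k =
      z k + ∑ i, if IsPivot R x i then 0 else pivotCoeff R x i (x i) k • z i := fun z => by
    unfold pivotTag
    congr!
  have h2 := congrFun h k
  rw [h3, h3] at h2
  rw [Finset.sum_congr rfl (g := fun i => if IsPivot R x i then 0 else
    pivotCoeff R x i (x i) k • y' i)] at h2
  · exact add_right_cancel h2
  · intro i _
    split_ifs with hi
    · rfl
    · rw [h1 i hi]

section Insert

variable {x : Fin n → V} {j : Fin (n + 1)} {v : V}

/-- The cut `t` of the longer sequence corresponds to the cut `s` of the shorter one; `hjt` makes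
the earlier entries span `v` whenever `v` lies before the cut. -/
theorem span_insertNth (hv : v ∈ Submodule.span R (x '' {k | (k : ℕ) < j})) {t : Fin (n + 1)}
    {s : ℕ} (hts : ∀ m : Fin n, j.succAbove m < t ↔ (m : ℕ) < s) (hjt : j < t → (j : ℕ) ≤ s) :
    Submodule.span R ((j.insertNth v x : Fin (n + 1) → V) '' {l | l < t}) =
      Submodule.span R (x '' {k | (k : ℕ) < s}) := by
  apply le_antisymm
  · refine Submodule.span_le.2 ?_
    rintro _ ⟨l, hl, rfl⟩
    have hl' : l < t := hl
    rcases Fin.eq_self_or_eq_succAbove j l with rfl | ⟨m, rfl⟩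
    · rw [Fin.insertNth_apply_same]
      exact Submodule.span_mono (Set.image_mono fun k (hk : _ < _) =>
        lt_of_lt_of_le hk (hjt hl')) hv
    · rw [Fin.insertNth_apply_succAbove]
      exact Submodule.subset_span ⟨m, (hts m).1 hl', rfl⟩
  · refine Submodule.span_mono ?_
    rintro _ ⟨k, hk, rfl⟩
    exact ⟨j.succAbove k, (hts k).2 hk, by rw [Fin.insertNth_apply_succAbove]⟩

theorem isPivot_insertNth_succAbove (hv : v ∈ Submodule.span R (x '' {k | (k : ℕ) < j}))
    (k : Fin n) : IsPivot R (j.insertNth v x : Fin (n + 1) → V) (j.succAbove k) ↔ IsPivot R x k := by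
  unfold IsPivot
  rw [Fin.insertNth_apply_succAbove, span_insertNth R hv (s := k)]
  · rfl
  · intro m
    rw [Fin.succAbove_lt_succAbove_iff, Fin.lt_def]
  · intro h
    rw [Fin.lt_succAbove_iff_le_castSucc] at h
    exact h

theorem not_isPivot_insertNth_same (hv : v ∈ Submodule.span R (x '' {k | (k : ℕ) < j})) :
    ¬ IsPivot R (j.insertNth v x : Fin (n + 1) → V) j := by
  unfold IsPivot
  rw [Fin.insertNth_apply_same, span_insertNth R hv (s := j), not_not]
  · exact hv
  · intro m
    rw [Fin.succAbove_lt_iff_castSucc_lt]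
    rfl
  · exact fun h => absurd h (lt_irrefl _)

theorem pivotsBefore_insertNth (hv : v ∈ Submodule.span R (x '' {k | (k : ℕ) < j}))
    {t : Fin (n + 1)} {s : ℕ} (hts : ∀ m : Fin n, j.succAbove m < t ↔ (m : ℕ) < s) :
    pivotsBefore R (j.insertNth v x : Fin (n + 1) → V) t = pivotsBefore R x s := by
  ext u
  constructor
  · rintro ⟨l, ⟨hlt, hl⟩, rfl⟩
    rcases Fin.eq_self_or_eq_succAbove j l with rfl | ⟨m, rfl⟩
    · exact absurd hl (not_isPivot_insertNth_same R hv)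
    · rw [Fin.insertNth_apply_succAbove]
      exact ⟨m, ⟨(hts m).1 hlt, (isPivot_insertNth_succAbove R hv m).1 hl⟩, rfl⟩
  · rintro ⟨k, ⟨hks, hk⟩, rfl⟩
    exact ⟨j.succAbove k, ⟨(hts k).2 hks, (isPivot_insertNth_succAbove R hv k).2 hk⟩,
      by rw [Fin.insertNth_apply_succAbove]⟩

theorem pivotCoeff_insertNth (hv : v ∈ Submodule.span R (x '' {k | (k : ℕ) < j}))
    {t : Fin (n + 1)} {s : ℕ} (hts : ∀ m : Fin n, j.succAbove m < t ↔ (m : ℕ) < s)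
    (u : V) (k : Fin n) :
    pivotCoeff R (j.insertNth v x : Fin (n + 1) → V) t u (j.succAbove k) =
      pivotCoeff R x s u k := by
  classical
  unfold pivotCoeff
  rw [pivotsBefore_insertNth R hv hts, Fin.insertNth_apply_succAbove]
  exact if_congr (isPivot_insertNth_succAbove R hv k) rfl rfl

/-- The new entry is a non-pivot and adds `pivotCoeff R x j v k • y i` to the tag at `k`, exactly
what was subtracted from `y k`. -/
theorem pivotTag_insertNth (hv : v ∈ Submodule.span R (x '' {k | (k : ℕ) < j})) (y : Fin n → V)
    {i : Fin n} (hi : ¬ IsPivot R x i) :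
    pivotTag R (j.insertNth v x : Fin (n + 1) → V)
        (j.insertNth (y i) fun k => y k - pivotCoeff R x j v k • y i) =
      j.insertNth (pivotTag R x y i) (pivotTag R x y) := by
  classical
  funext t
  rcases Fin.eq_self_or_eq_succAbove j t with rfl | ⟨k, rfl⟩
  · rw [pivotTag_of_not_isPivot R _ (not_isPivot_insertNth_same R hv), Fin.insertNth_apply_same,
      Fin.insertNth_apply_same, pivotTag_of_not_isPivot R _ hi]
  · rw [Fin.insertNth_apply_succAbove]
    unfold pivotTag
    rw [Fin.sum_univ_succAbove _ j, if_neg (not_isPivot_insertNth_same R hv),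
      Fin.insertNth_apply_same, Fin.insertNth_apply_same, Fin.insertNth_apply_succAbove,
      pivotCoeff_insertNth R hv (s := j)]
    · rw [← add_assoc, sub_add_cancel]
      congr 1
      refine Finset.sum_congr rfl fun l _ => ?_
      rw [Fin.insertNth_apply_succAbove, Fin.insertNth_apply_succAbove]
      -- The correction vanishes at non-pivots, so the other summands do not change.
      refine if_ctx_congr (isPivot_insertNth_succAbove R hv l) (fun _ => rfl) fun hl => ?_
      rw [pivotCoeff_of_not_isPivot R hl, zero_smul, sub_zero,
        pivotCoeff_insertNth R hv (s := l)]
      intro m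
      rw [Fin.succAbove_lt_succAbove_iff, Fin.lt_def]
    · intro m
      rw [Fin.succAbove_lt_iff_castSucc_lt]
      rfl

end Insert

/-- The word of a pair of sequences: the vectors, their tags, and the positions of the pivots. -/
noncomputable def pivotWord (x y : Fin n → V) (k : Fin n) : V × V × Prop :=
  (x k, pivotTag R x y k, IsPivot R x k)

theorem pivotWord_insertNth {x : Fin n → V} {j : Fin (n + 1)} {i : Fin n} (hij : i.castSucc < j)
    (y : Fin n → V) (hi : ¬ IsPivot R x i) :
    pivotWord R (j.insertNth (x i) x : Fin (n + 1) → V)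
        (j.insertNth (y i) fun k => y k - pivotCoeff R x j (x i) k • y i) =
      j.insertNth (pivotWord R x y i) (pivotWord R x y) := by
  have hv : x i ∈ Submodule.span R (x '' {k | (k : ℕ) < j}) := Submodule.subset_span ⟨i, hij, rfl⟩
  funext t
  unfold pivotWord
  rw [pivotTag_insertNth R hv y hi]
  rcases Fin.eq_self_or_eq_succAbove j t with rfl | ⟨k, rfl⟩
  · rw [Fin.insertNth_apply_same, Fin.insertNth_apply_same, Fin.insertNth_apply_same,
      eq_false hi, eq_false (not_isPivot_insertNth_same R hv)]
  · rw [Fin.insertNth_apply_succAbove, Fin.insertNth_apply_succAbove,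
      Fin.insertNth_apply_succAbove, propext (isPivot_insertNth_succAbove R hv k)]

/-- The later of two equal letters repeats an earlier vector, so it is not a pivot. -/
theorem duplicate_ofFn_pivotWord {x y : Fin n → V} {a : V × V × Prop}
    (h : List.Duplicate a (List.ofFn (pivotWord R x y))) : ¬ a.2.2 := by
  rw [List.duplicate_iff_exists_distinct_get] at h
  obtain ⟨k, l, hkl, hk, hl⟩ := h
  rw [List.get_ofFn] at hk hl
  subst hl
  simp only [pivotWord]
  rw [IsPivot, not_not]
  refine Submodule.subset_span ⟨_, ?_, (congrArg Prod.fst hk).symm⟩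
  exact hkl

end Pivots

/-! ### Insertion, lexicographic order and lists -/

section Lex

variable {α : Type*} {n : ℕ}

/-- Either the first difference lies before `j` and decides, or the sequences agree before `j` and
the inserted entries are equal. -/
theorem toLex_insertNth_lt [LinearOrder α] {a b : Fin n → α} (h : toLex a < toLex b)
    {j : Fin (n + 1)} {u v : α} (huv : (∀ k : Fin n, (k : ℕ) < j → a k = b k) → u = v) :
    toLex (j.insertNth u a : Fin (n + 1) → α) < toLex (j.insertNth v b : Fin (n + 1) → α) := by
  obtain ⟨c, hc, hlt⟩ := h
  refine ⟨j.succAbove c, fun t ht => ?_, ?_⟩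
  · change (j.insertNth u a : Fin (n + 1) → α) t = (j.insertNth v b : Fin (n + 1) → α) t
    rcases Fin.eq_self_or_eq_succAbove j t with rfl | ⟨k, rfl⟩
    · rw [Fin.insertNth_apply_same, Fin.insertNth_apply_same]
      have ht' := (Fin.lt_succAbove_iff_le_castSucc _ _).1 ht
      exact huv fun k hk => hc k (Fin.lt_def.2 (lt_of_lt_of_le hk ht'))
    · rw [Fin.insertNth_apply_succAbove, Fin.insertNth_apply_succAbove]
      exact hc k (Fin.succAbove_lt_succAbove_iff.1 ht)
  · change (j.insertNth u a : Fin (n + 1) → α) _ < (j.insertNth v b : Fin (n + 1) → α) _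
    rw [Fin.insertNth_apply_succAbove, Fin.insertNth_apply_succAbove]
    exact hlt

theorem List.ofFn_insertNth (j : Fin (n + 1)) (a : α) (f : Fin n → α) :
    List.ofFn (j.insertNth a f : Fin (n + 1) → α) = (List.ofFn f).insertIdx j a := by
  apply List.ext_getElem
  · rw [List.length_insertIdx_of_le_length] <;> simp
    exact Nat.le_of_lt_succ j.2
  · intro t h1 h2
    rw [List.getElem_ofFn, List.getElem_insertIdx]
    have ht : t < n + 1 := by simpa using h1
    rcases Fin.eq_self_or_eq_succAbove j ⟨t, ht⟩ with h | ⟨k, h⟩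
    · rw [h]
      have : t = j := congrArg Fin.val h
      simp [this]
    · rw [h, Fin.insertNth_apply_succAbove]
      have hv : t = (j.succAbove k : Fin (n + 1)) := congrArg Fin.val h
      rcases lt_or_ge (k.castSucc) j with hk | hk
      · rw [Fin.succAbove_of_castSucc_lt _ _ hk] at hv
        simp only [Fin.val_castSucc] at hv
        subst hv
        have : (k : ℕ) < j := hk
        simp [this]
      · rw [Fin.succAbove_of_le_castSucc _ _ hk] at hv
        simp only [Fin.val_succ] at hv
        subst hv
        have : (j : ℕ) ≤ k := hk
        have h3 : ¬ (k : ℕ) + 1 < j := by omega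
        have h4 : ¬ (k : ℕ) + 1 = j := by omega
        simp [h3, h4]

theorem List.insertIdx_length_append (l l' : List α) (a : α) :
    (l ++ l').insertIdx l.length a = l ++ a :: l' := by
  induction l with
  | nil => simp
  | cons b l ih => simp [ih]

theorem List.CopyStep.exists_insertNth {p : α → Prop} {f : Fin n → α} {l : List α}
    (h : List.CopyStep p (List.ofFn f) l) :
    ∃ (j : Fin (n + 1)) (i : Fin n), i.castSucc < j ∧ p (f i) ∧
      l = List.ofFn (j.insertNth (f i) f : Fin (n + 1) → α) := by
  generalize hw : List.ofFn f = w at h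
  obtain ⟨hp, ha⟩ := h
  rename_i l₁ l₂ a
  have hlen : n = l₁.length + l₂.length := by
    rw [← List.length_append, ← hw, List.length_ofFn]
  obtain ⟨i, hi, rfl⟩ := List.getElem_of_mem ha
  have hfi : f ⟨i, by omega⟩ = l₁[i] := by
    have : (List.ofFn f)[i]'(by rw [List.length_ofFn]; omega) = f ⟨i, by omega⟩ := by simp
    rw [← this]
    simp only [hw]
    exact List.getElem_append_left hi
  refine ⟨⟨l₁.length, by omega⟩, ⟨i, by omega⟩, hi, by rwa [hfi], ?_⟩
  rw [List.ofFn_insertNth, hw, hfi]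
  exact (List.insertIdx_length_append _ _ _).symm

end Lex

/-! ### Morphisms of `VIC(R, U)` as pairs of sequences of vectors -/

namespace VIC

variable {R : Type*} [CommRing R] {U : Subgroup Rˣ}

namespace Hom

variable {X Y Z : VIC R U}

/-- The retraction of `f` with kernel `C`, for a morphism `(f, C)`. -/
noncomputable def retraction (p : Hom X Y) : (Fin Y.rank → R) →ₗ[R] (Fin X.rank → R) :=
  (LinearEquiv.ofInjective p.toLin p.injective).symm ∘ₗ
    Submodule.projectionOnto _ _ p.isCompl

theorem retraction_toLin (p : Hom X Y) (v : Fin X.rank → R) : p.retraction (p.toLin v) = v := by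
  rw [retraction, LinearMap.comp_apply,
    Submodule.projectionOnto_apply_of_mem_left p.isCompl (LinearMap.mem_range_self p.toLin v)]
  exact (LinearEquiv.ofInjective p.toLin p.injective).symm_apply_apply v

theorem retraction_eq_zero_iff (p : Hom X Y) (v : Fin Y.rank → R) :
    p.retraction v = 0 ↔ v ∈ p.compl := by
  rw [retraction, LinearMap.comp_apply, LinearEquiv.coe_coe, LinearEquiv.map_eq_zero_iff,
    Submodule.projectionOnto_apply_eq_zero_iff]

theorem eq_retraction (p : Hom X Y) {r : (Fin Y.rank → R) →ₗ[R] (Fin X.rank → R)}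
    (h₁ : ∀ v, r (p.toLin v) = v) (h₂ : ∀ v ∈ p.compl, r v = 0) : p.retraction = r := by
  refine LinearMap.ext fun v => ?_
  obtain ⟨_, ⟨a, rfl⟩, c, hc, rfl⟩ := Submodule.mem_sup.1
    (p.isCompl.sup_eq_top.ge (Submodule.mem_top (x := v)))
  rw [map_add, map_add, retraction_toLin, h₁, h₂ c hc, (retraction_eq_zero_iff p c).2 hc]

theorem ext_retraction {p q : Hom X Y} (h₁ : p.toLin = q.toLin)
    (h₂ : p.retraction = q.retraction) : p = q := by
  refine Hom.ext h₁ ?_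
  ext v
  rw [← retraction_eq_zero_iff, ← retraction_eq_zero_iff, h₂]

theorem retraction_comp (p : Hom X Y) (q : Hom Y Z) :
    (p.comp q).retraction = p.retraction ∘ₗ q.retraction := by
  refine eq_retraction _ (fun v => ?_) fun v hv => ?_
  · change p.retraction (q.retraction (q.toLin (p.toLin v))) = v
    rw [retraction_toLin, retraction_toLin]
  · obtain ⟨_, ⟨a, ha, rfl⟩, c, hc, rfl⟩ := Submodule.mem_sup.1 hv
    rw [LinearMap.comp_apply, map_add, retraction_toLin, (retraction_eq_zero_iff q c).2 hc,
      add_zero]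
    exact (retraction_eq_zero_iff p a).2 ha

/-- The columns of the matrix of the retraction of a morphism. -/
noncomputable def cols (p : Hom X Y) (k : Fin Y.rank) : Fin X.rank → R :=
  p.retraction (Pi.single k 1)

/-- The rows of the matrix of a morphism. -/
noncomputable def rows (p : Hom X Y) (k : Fin Y.rank) : Fin X.rank → R :=
  fun a => p.toLin (Pi.single a 1) k

theorem ext_cols_rows {p q : Hom X Y} (h₁ : p.cols = q.cols) (h₂ : p.rows = q.rows) : p = q := by
  refine ext_retraction ?_ ?_
  · refine LinearMap.pi_ext' fun a => LinearMap.ext_ring ?_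
    funext k
    exact congrFun (congrFun h₂ k) a
  · refine LinearMap.pi_ext' fun a => LinearMap.ext_ring ?_
    exact congrFun h₁ a

end Hom

/-- The object that follows `Y` in the order of ranks. -/
abbrev succ (Y : VIC R U) : VIC R U := ⟨Y.rank + 1⟩

/-! ### Elementary morphisms that raise the rank by one -/

section Insert

variable {n : ℕ} (j : Fin (n + 1)) (i : Fin n) (w : Fin n → R)

/-- The linear map that inserts a copy of the coordinate `i` at `j` and subtracts from the other
coordinates the products of the coordinate `i` and the entries of `w`. -/
def insertLin : (Fin n → R) →ₗ[R] (Fin (n + 1) → R) where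
  toFun v := j.insertNth (v i) fun k => v k - w k * v i
  map_add' u v := by
    funext t
    rcases Fin.eq_self_or_eq_succAbove j t with rfl | ⟨k, rfl⟩
    · simp
    · simp only [Fin.insertNth_apply_succAbove, Pi.add_apply]
      ring
  map_smul' c v := by
    funext t
    rcases Fin.eq_self_or_eq_succAbove j t with rfl | ⟨k, rfl⟩
    · simp
    · simp only [Fin.insertNth_apply_succAbove, Pi.smul_apply, smul_eq_mul, RingHom.id_apply]
      ring

/-- The linear map that deletes the coordinate `j` and adds its product with `w`. -/
def deleteLin : (Fin (n + 1) → R) →ₗ[R] (Fin n → R) where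
  toFun u k := u (j.succAbove k) + w k * u j
  map_add' u v := by
    funext k
    simp only [Pi.add_apply]
    ring
  map_smul' c v := by
    funext k
    simp only [Pi.smul_apply, smul_eq_mul, RingHom.id_apply]
    ring

theorem deleteLin_insertLin (v : Fin n → R) : deleteLin j w (insertLin j i w v) = v := by
  funext k
  simp [deleteLin, insertLin]

/-- The kernel of `deleteLin` has rank one. -/
def kerDeleteLinEquiv : LinearMap.ker (deleteLin j w) ≃ₗ[R] R where
  toFun u := u.1 j
  map_add' _ _ := rfl
  map_smul' _ _ := rfl
  invFun t := ⟨j.insertNth t fun k => -(w k * t), by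
    rw [LinearMap.mem_ker]
    funext k
    simp [deleteLin]⟩
  left_inv u := by
    apply Subtype.ext
    funext t
    rcases Fin.eq_self_or_eq_succAbove j t with rfl | ⟨k, rfl⟩
    · simp
    · have h : u.1 (j.succAbove k) + w k * u.1 j = 0 := congrFun u.2 k
      simp only [Fin.insertNth_apply_succAbove]
      exact (eq_neg_of_add_eq_zero_left h).symm
  right_inv t := by simp

end Insert

theorem isCompl_range_ker {A B : Type*} [AddCommGroup A] [AddCommGroup B] [Module R A] [Module R B]
    (f : A →ₗ[R] B) (r : B →ₗ[R] A) (h : ∀ a, r (f a) = a) :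
    IsCompl (LinearMap.range f) (LinearMap.ker r) := by
  constructor
  · rw [Submodule.disjoint_def]
    rintro _ ⟨a, rfl⟩ ha
    rw [LinearMap.mem_ker, h] at ha
    rw [ha, map_zero]
  · rw [codisjoint_iff_le_sup]
    intro b _
    refine Submodule.mem_sup.2 ⟨f (r b), LinearMap.mem_range_self f _, b - f (r b), ?_,
      add_sub_cancel _ _⟩
    rw [LinearMap.mem_ker, map_sub, h, sub_self]

/-- The morphism of `VIC(R, U)` given by inserting a coordinate. -/
noncomputable def insertHom (Y : VIC R U) (j : Fin (Y.rank + 1)) (i : Fin Y.rank)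
    (w : Fin Y.rank → R) : Hom Y Y.succ where
  toLin := insertLin j i w
  compl := LinearMap.ker (deleteLin j w)
  injective := Function.LeftInverse.injective (deleteLin_insertLin j i w)
  free := Module.Free.of_equiv (kerDeleteLinEquiv j w).symm
  isCompl := isCompl_range_ker _ _ (deleteLin_insertLin j i w)
  -- The ranks differ, so the subgroup `U` imposes no condition.
  det_mem h := absurd h (Nat.succ_ne_self _).symm

theorem retraction_insertHom (Y : VIC R U) (j : Fin (Y.rank + 1)) (i : Fin Y.rank)
    (w : Fin Y.rank → R) : (insertHom Y j i w).retraction = deleteLin j w :=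
  Hom.eq_retraction _ (deleteLin_insertLin j i w) fun _ hv => hv

namespace Hom

variable {X Y : VIC R U}

/-- The retraction composes with `deleteLin`, which sends the new basis vector to `w`; so the new
column is the combination of the old ones with coefficients `w`. -/
theorem cols_comp_insertHom (p : Hom X Y) (j : Fin (Y.rank + 1)) (i : Fin Y.rank)
    (w : Fin Y.rank → R) :
    (p.comp (insertHom Y j i w)).cols = (j.insertNth (∑ k, w k • p.cols k) p.cols :
      Fin (Y.rank + 1) → Fin X.rank → R) := by
  funext t
  unfold cols
  rw [retraction_comp, retraction_insertHom, LinearMap.comp_apply]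
  rcases Fin.eq_self_or_eq_succAbove j t with rfl | ⟨k, rfl⟩
  · rw [Fin.insertNth_apply_same]
    simp only [← map_smul, ← map_sum]
    congr 1
    funext k
    simp [deleteLin, Finset.sum_apply, Pi.single_apply]
  · rw [Fin.insertNth_apply_succAbove]
    congr 1
    funext l
    simp [deleteLin, Pi.single_apply]

theorem rows_comp_insertHom (p : Hom X Y) (j : Fin (Y.rank + 1)) (i : Fin Y.rank)
    (w : Fin Y.rank → R) :
    (p.comp (insertHom Y j i w)).rows =
      (j.insertNth (p.rows i) fun k => p.rows k - w k • p.rows i :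
        Fin (Y.rank + 1) → Fin X.rank → R) := by
  funext t a
  change insertLin j i w (p.toLin (Pi.single a 1)) t = _
  rcases Fin.eq_self_or_eq_succAbove j t with rfl | ⟨k, rfl⟩
  · rw [Fin.insertNth_apply_same]
    simp [insertLin, rows]
  · rw [Fin.insertNth_apply_succAbove]
    simp [insertLin, rows]

/-- The word of a morphism. -/
noncomputable def word (p : Hom X Y) : List ((Fin X.rank → R) × (Fin X.rank → R) × Prop) :=
  List.ofFn (pivotWord R p.cols p.rows)

/-- The tags of the rows of a morphism. -/
noncomputable def tags (p : Hom X Y) : Fin Y.rank → Fin X.rank → R :=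
  pivotTag R p.cols p.rows

theorem ext_cols_tags {p q : Hom X Y} (h₁ : p.cols = q.cols) (h₂ : p.tags = q.tags) : p = q := by
  refine ext_cols_rows h₁ (pivotTag_injective R p.cols ?_)
  unfold tags at h₂
  rw [h₂, h₁]

theorem sigma_eq_of_word_eq {p : Σ Y, Hom X Y} {q : Σ Y, Hom X Y} (h : p.2.word = q.2.word) :
    p = q := by
  obtain ⟨⟨m⟩, p⟩ := p
  obtain ⟨⟨n⟩, q⟩ := q
  obtain rfl : m = n := by
    have := congrArg List.length h
    simpa [word] using this
  have h1 : pivotWord R p.cols p.rows = pivotWord R q.cols q.rows := List.ofFn_injective h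
  congr 1
  exact ext_cols_tags (funext fun k => congrArg Prod.fst (congrFun h1 k))
    (funext fun k => congrArg (fun a => a.2.1) (congrFun h1 k))

section Order

/-- The lexicographic comparison key of a morphism: its columns, followed by its tags. -/
noncomputable def key (p : Hom X Y) :
    Lex (Fin Y.rank → Fin X.rank → R) ×ₗ Lex (Fin Y.rank → Fin X.rank → R) :=
  toLex (toLex p.cols, toLex p.tags)

theorem key_injective : Function.Injective (key : Hom X Y → _) := by
  intro p q h
  have h' : (toLex p.cols, toLex p.tags) = (toLex q.cols, toLex q.tags) := toLex.injective h
  rw [Prod.mk.injEq] at h'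
  exact ext_cols_tags (toLex.injective h'.1) (toLex.injective h'.2)

variable [LinearOrder (Fin X.rank → R)]

/-- The morphism is `insertHom` with `w` adapted to the columns of `p`. For other `q` it inserts a
combination of columns before `j`, which is enough for comparisons with `p`. -/
theorem exists_comp_of_copyStep (p : Hom X Y) {l : List ((Fin X.rank → R) × (Fin X.rank → R) × Prop)}
    (h : List.CopyStep (fun a => ¬ a.2.2) p.word l) :
    ∃ g : Hom Y Y.succ, (p.comp g).word = l ∧
      ∀ q : Hom X Y, q.key < p.key → (q.comp g).key < (p.comp g).key := by
  obtain ⟨j, i, hij, hi, rfl⟩ := h.exists_insertNth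
  have hi : ¬ IsPivot R p.cols i := hi
  have hv : p.cols i ∈ Submodule.span R (p.cols '' {k | (k : ℕ) < j}) :=
    Submodule.subset_span ⟨i, hij, rfl⟩
  set w := pivotCoeff R p.cols j (p.cols i) with hw
  have hsum : ∑ k, w k • p.cols k = p.cols i := sum_pivotCoeff R p.cols hv
  -- Tags are compared only when the columns agree; then `q` has the same pivots and coefficients,
  -- and its tags also undergo a plain copy.
  have htags : ∀ q : Hom X Y, q.cols = p.cols → (q.comp (insertHom Y j i w)).tags =
      (j.insertNth (q.tags i) q.tags : Fin (Y.rank + 1) → Fin X.rank → R) := by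
    intro q hq
    unfold tags
    rw [cols_comp_insertHom, rows_comp_insertHom, hq, hsum]
    exact pivotTag_insertNth R hv q.rows hi
  refine ⟨insertHom Y j i w, ?_, fun q hq => ?_⟩
  · unfold word
    rw [cols_comp_insertHom, rows_comp_insertHom, hsum]
    exact congrArg List.ofFn (pivotWord_insertNth R hij p.rows hi)
  · unfold key at hq ⊢
    rw [Prod.Lex.toLex_lt_toLex] at hq ⊢
    rcases hq with hlt | ⟨heq, hlt⟩
    · left
      simp only [cols_comp_insertHom]
      -- As `w` vanishes from `j` on, the inserted columns agree if the columns before `j` do.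
      refine toLex_insertNth_lt hlt fun h => Finset.sum_congr rfl fun k _ => ?_
      rcases lt_or_ge (k : ℕ) j with hk | hk
      · rw [h k hk]
      · rw [hw, pivotCoeff_of_le R _ _ hk, zero_smul, zero_smul]
    · right
      have heq' : q.cols = p.cols := toLex.injective heq
      refine ⟨?_, ?_⟩
      · simp only [cols_comp_insertHom, heq']
      · simp only [htags q heq', htags p rfl]
        exact toLex_insertNth_lt hlt fun h => h i hij

theorem exists_comp_of_reflTransGen_copyStep (p : Hom X Y)
    {l : List ((Fin X.rank → R) × (Fin X.rank → R) × Prop)}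
    (h : Relation.ReflTransGen (List.CopyStep fun a => ¬ a.2.2) p.word l) :
    ∃ (Z : VIC R U) (g : Hom Y Z), (p.comp g).word = l ∧
      ∀ q : Hom X Y, q.key < p.key → (q.comp g).key < (p.comp g).key := by
  induction h with
  | refl =>
    have hid : ∀ q : Hom X Y, q.comp (Hom.id Y) = q := fun q => Category.comp_id (X := X) (Y := Y) q
    exact ⟨Y, Hom.id Y, by rw [hid], fun q hq => by rwa [hid, hid]⟩
  | tail _ hstep ih =>
    obtain ⟨Z, g, rfl, hg⟩ := ih
    obtain ⟨g', hg', hlt⟩ := exists_comp_of_copyStep _ hstep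
    have hassoc : ∀ q : Hom X Y, q.comp (g.comp g') = (q.comp g).comp g' := fun q =>
      (Category.assoc (W := X) (X := Y) (Y := Z) (Z := Z.succ) q g g').symm
    refine ⟨Z.succ, g.comp g', by rw [hassoc, hg'], fun q hq => ?_⟩
    rw [hassoc, hassoc]
    exact hlt _ (hg q hq)

end Order

end Hom

/-- Finiteness of `R` is used twice: there are finitely many keys for each target, so their linear
order is a well-order, and the alphabet of the words is finite. -/
theorem admitsMonomialOrders [Finite R] (X : VIC R U) : AdmitsMonomialOrders X := by
  classical
  let := linearOrderOfSTO (WellOrderingRel (α := Fin X.rank → R))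
  refine ⟨fun Y (p q : Hom X Y) => p.key < q.key, fun Y => ?_, ?_⟩
  · have : Finite (Lex (Fin Y.rank → Fin X.rank → R) ×ₗ Lex (Fin Y.rank → Fin X.rank → R)) :=
      inferInstanceAs (Finite ((Fin Y.rank → Fin X.rank → R) × (Fin Y.rank → Fin X.rank → R)))
    let e : (fun p q : Hom X Y => p.key < q.key) ↪r
        ((· < ·) : (Lex (Fin Y.rank → Fin X.rank → R) ×ₗ Lex (Fin Y.rank → Fin X.rank → R)) →
          _ → Prop) := ⟨⟨Hom.key, Hom.key_injective⟩, Iff.rfl⟩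
    exact e.isWellOrder
  · intro s
    obtain ⟨m, n, hmn, h⟩ := List.exists_reflTransGen_copyStep
      (fun n => Hom.word (X := X) (s n).2) fun n a ha => duplicate_ofFn_pivotWord R ha
    obtain ⟨Z, g, hg, hlt⟩ := Hom.exists_comp_of_reflTransGen_copyStep _ h
    have hs : (⟨Z, Hom.comp (s m).2 g⟩ : Σ Y, Hom X Y) = s n := Hom.sigma_eq_of_word_eq hg
    refine ⟨m, n, hmn, ?_⟩
    rw [← hs]
    exact ⟨g, rfl, hlt⟩

end VIC

/-! ### Unitization of a left Noetherian ring -/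

/-- As for extensions of Noetherian modules: a chain of left ideals of `S` is stationary once its
preimages in `k` and its images in `ℤ` are. -/
theorem isNoetherianRing_of_ker_le_range {k S : Type*} [NonUnitalRing k] [Ring S]
    (hk : IsLeftNoetherianNonUnital k) (p : S →+* ℤ) (ι : k →ₙ+* S)
    (hp : ∀ s, p s = 0 → ∃ r, ι r = s) : IsNoetherianRing S := by
  refine monotone_stabilizes_iff_noetherian.1 fun N => ?_
  let I : ℕ →o AddSubgroup k :=
    ⟨fun n => (N n).toAddSubgroup.comap (ι : k →+ S),
      fun m n hmn x (hx : ι x ∈ N m) => show ι x ∈ N n from N.monotone hmn hx⟩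
  let J : ℕ →o Ideal ℤ :=
    ⟨fun n => AddSubgroup.toIntSubmodule ((N n).toAddSubgroup.map (p : S →+ ℤ)), by
      rintro m n hmn _ ⟨x, hx, rfl⟩
      exact ⟨x, N.monotone hmn hx, rfl⟩⟩
  obtain ⟨n₁, h₁⟩ := hk I fun n a x hx => by
    change ι (a * x) ∈ N n
    rw [map_mul]
    exact (N n).smul_mem (ι a) hx
  obtain ⟨n₂, h₂⟩ := monotone_stabilizes_iff_noetherian.2 (inferInstanceAs (IsNoetherian ℤ ℤ)) J
  refine ⟨max n₁ n₂, fun m hm => le_antisymm (N.monotone hm) fun x hx => ?_⟩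
  have hJ : p x ∈ J (max n₁ n₂) := by
    rw [← h₂ _ (le_max_right _ _), h₂ m (le_trans (le_max_right _ _) hm)]
    exact ⟨x, hx, rfl⟩
  obtain ⟨y, hy, hyx⟩ := hJ
  have hyx : p y = p x := hyx
  -- Two elements with the same image in `ℤ` differ by an element coming from `k`.
  obtain ⟨r, hr⟩ := hp (x - y) (by rw [map_sub, hyx, sub_self])
  have hI : r ∈ I (max n₁ n₂) := by
    rw [← h₁ _ (le_max_left _ _), h₁ m (le_trans (le_max_left _ _) hm)]
    change ι r ∈ N m
    rw [hr]
    exact (N m).sub_mem hx (N.monotone hm hy)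
  have hI' : ι r ∈ N (max n₁ n₂) := hI
  rw [hr] at hI'
  simpa using (N _).add_mem hI' hy

/-- A left Noetherian ring without unit embeds in a left Noetherian ring with unit whose elements
are the sums of an integer and an element of the given ring, and all actions extend. -/
theorem exists_unital_extension {k : Type v} [NonUnitalRing k] (hk : IsLeftNoetherianNonUnital k) :
    ∃ (S : Type v) (_ : Ring S) (_ : IsNoetherianRing S) (p : S → ℤ) (q : S → k) (ι : k → S),
      (∀ r, p (ι r) = 0 ∧ q (ι r) = r) ∧
      ∀ (A : Type w) [AddCommGroup A] (f : k →ₙ+* AddMonoid.End A),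
        ∃ F : S →+* AddMonoid.End A, ∀ s x, F s x = p s • x + f (q s) x := by
  refine ⟨Unitization ℤ k, inferInstance, isNoetherianRing_of_ker_le_range hk
    (Unitization.fstHom ℤ k).toRingHom (Unitization.inrNonUnitalAlgHom ℤ k : k →ₙ+* Unitization ℤ k) fun s hs => ?_,
    fun s => s.fst, fun s => s.snd, Unitization.inr,
    fun r => ⟨Unitization.fst_inr ℤ r, Unitization.snd_inr ℤ r⟩, fun A _ f => ?_⟩
  · exact ⟨s.snd, Unitization.ext hs.symm rfl⟩
  let f' : k →ₙₐ[ℤ] AddMonoid.End A := { f with map_smul' := fun n a => map_zsmul f n a }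
  refine ⟨(Unitization.lift f').toRingHom, fun s x => ?_⟩
  change (algebraMap ℤ (AddMonoid.End A) s.fst + f s.snd) x = _
  rw [algebraMap_int_eq, eq_intCast]
  rfl

/-! ### Noetherianity over unital and non-unital coefficient rings -/

section

variable {C : Type*} [Category C]

theorem CatSubmodule.fg_of_admitsMonomialOrders (hC : ∀ X : C, AdmitsMonomialOrders X)
    {k : Type v} [Ring k] [IsNoetherianRing k] {M : C ⥤ ModuleCat.{w} k}
    (hM : (CatSubmodule.whole M).FG) (N : CatSubmodule M) : N.FG := by
  obtain ⟨n, c, x, -, hx⟩ := hM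
  have hcomp : ∀ {X Y Z : C} (f : X ⟶ Y) (g : Y ⟶ Z) (a : M.obj X),
      (M.map (f ≫ g)).hom a = (M.map g).hom ((M.map f).hom a) := fun f g a => by
    rw [M.map_comp]
    rfl
  let P : CatSubmodule M :=
    { obj := fun Y => Submodule.span k {z | ∃ i, ∃ f : c i ⟶ Y, z = (M.map f).hom (x i)}
      map_mem := fun {Y Z} g a ha => by
        refine Submodule.span_le (p := (Submodule.span k _).comap (M.map g).hom).2 ?_ ha
        rintro _ ⟨i, f, rfl⟩
        exact Submodule.subset_span ⟨i, f ≫ g, (hcomp f g _).symm⟩ }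
  obtain ⟨m, d, y, hyN, hy⟩ := exists_finite_generators_of_admitsMonomialOrders hC
    (fun Y => M.obj Y) (fun f => (M.map f).hom) hcomp c x
    (hx P fun i => Submodule.subset_span ⟨i, 𝟙 _, by rw [M.map_id]; rfl⟩) N.obj N.map_mem
  exact ⟨m, d, y, hyN, fun Q hQ => hy Q.obj Q.map_mem hQ⟩

/-- Over the unital extension `S` the values are unital modules, and the `S`-submodules are exactly
the subgroups stable under `k`, so finite generation has the same meaning for both rings. -/
theorem NonUnitalCatSubmodule.fg_of_admitsMonomialOrders (hC : ∀ X : C, AdmitsMonomialOrders X)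
    {k : Type v} [NonUnitalRing k] (hk : IsLeftNoetherianNonUnital k)
    {M : NonUnitalCatModule.{v, w} k C} (hM : (NonUnitalCatSubmodule.whole M).FG)
    (N : NonUnitalCatSubmodule M) : N.FG := by
  obtain ⟨S, _, _, p, q, ι, hι, hS⟩ := exists_unital_extension.{v, w} hk
  choose F hF using fun Y : C => hS (M.toFunctor.obj Y) (M.act Y)
  obtain ⟨n, c, x, -, hx⟩ := hM
  let (Y : C) : Module (S) (M.toFunctor.obj Y) :=
    Module.compHom _ (F Y)
  have hsmul : ∀ (Y : C) (r : S) (a : M.toFunctor.obj Y),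
      r • a = p r • a + M.act Y (q r) a := fun Y r a => hF Y r a
  have hinr : ∀ (Y : C) (r : k) (a : M.toFunctor.obj Y),
      ι r • a = M.act Y r a := fun Y r a => by
    rw [hsmul, (hι r).1, (hι r).2, zero_smul, zero_add]
  have hcomp : ∀ {X Y Z : C} (f : X ⟶ Y) (g : Y ⟶ Z) (a : M.toFunctor.obj X),
      (M.toFunctor.map (f ≫ g)).hom a = (M.toFunctor.map g).hom ((M.toFunctor.map f).hom a) :=
    fun f g a => by
      rw [M.toFunctor.map_comp]
      rfl
  let lin : ∀ {Y Z : C}, (Y ⟶ Z) → M.toFunctor.obj Y →ₗ[S] M.toFunctor.obj Z :=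
    fun {Y Z} f =>
      { toFun := (M.toFunctor.map f).hom
        map_add' := map_add _
        map_smul' := fun r a => by
          rw [RingHom.id_apply, hsmul, hsmul, map_add, map_zsmul, M.act_map] }
  -- An element of `S` acts as an integer plus an element of `k`, and integers preserve every
  -- subgroup.
  let toSub : NonUnitalCatSubmodule M → ∀ Y, Submodule (S) (M.toFunctor.obj Y) :=
    fun Q Y =>
      { Q.obj Y with
        smul_mem' := fun r a ha => by
          rw [hsmul]
          exact (Q.obj Y).add_mem ((Q.obj Y).zsmul_mem ha _) (Q.smul_mem _ _ ha) }
  let P : NonUnitalCatSubmodule M :=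
    { obj := fun Y => (Submodule.span (S)
        {z : M.toFunctor.obj Y | ∃ i, ∃ f : c i ⟶ Y, z = lin f (x i)}).toAddSubgroup
      smul_mem := fun {Y} r a ha => by
        rw [← hinr]
        exact Submodule.smul_mem _ _ ha
      map_mem := fun {Y Z} g a ha => by
        refine Submodule.span_le (p := (Submodule.span (S) _).comap (lin g)).2 ?_ ha
        rintro _ ⟨i, f, rfl⟩
        exact Submodule.subset_span ⟨i, f ≫ g, (hcomp f g _).symm⟩ }
  obtain ⟨m, d, y, hyN, hy⟩ := exists_finite_generators_of_admitsMonomialOrders hC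
    (fun Y => M.toFunctor.obj Y) lin hcomp c x
    (hx P fun i => Submodule.subset_span ⟨i, 𝟙 _, by
      change x i = (M.toFunctor.map (𝟙 (c i))).hom (x i)
      rw [M.toFunctor.map_id]
      rfl⟩) (toSub N) N.map_mem
  exact ⟨m, d, y, hyN, fun Q hQ => hy (toSub Q) Q.map_mem hQ⟩

end

theorem theoremC {R : Type u} [CommRing R] [Finite R] (U : Subgroup Rˣ) :
    (∀ (k : Type v) [Ring k] [IsNoetherianRing k] (M : VIC R U ⥤ ModuleCat.{w} k),
      (CatSubmodule.whole M).FG → ∀ N : CatSubmodule M, N.FG) ∧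
    (∀ (k : Type v) [NonUnitalRing k], IsLeftNoetherianNonUnital k →
      ∀ M : NonUnitalCatModule.{v, w} k (VIC R U),
        (NonUnitalCatSubmodule.whole M).FG → ∀ N : NonUnitalCatSubmodule M, N.FG) :=
  ⟨fun _ _ _ _ hM N => CatSubmodule.fg_of_admitsMonomialOrders VIC.admitsMonomialOrders hM N,
    fun _ _ hk _ hM N =>
      NonUnitalCatSubmodule.fg_of_admitsMonomialOrders VIC.admitsMonomialOrders hk hM N⟩
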